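/- **Theorem 1.** Consider $T$ rounds of a contextual bandit with action set $\{1,\dots,K\}$ under the disjoint linear reward model: in round $t$ a context $x_t\in\mathbb R^d$ is revealed, an action $a_t$ is played, and only the reward $r_t=\langle x_t,\theta^*_{a_t}\rangle+\eta_t$ is observed, where $\theta^*_1,\dots,\theta^*_K\in\mathbb R^d$ are unknown and $\eta_t$ is $\sigma$-subgaussian given the past: $\mathbb E[e^{s\eta_t}\mid x_1,\dots,x_t,a_1,\dots,a_t,r_1,\dots,r_{t-1}]\le e^{s^2\sigma^2/2}$ for all $s\in\mathbb R$. The contexts may be any random vectors (for instance an i.i.d. sample from an unknown distribution). Assume $\|x_t\|\le S_x$ for all $t$ and $\|\theta^*_a\|\le S_\theta$ for all $a$. Let $\lambda>0$ and $\delta\in(0,1)$. The mOFUL algorithm keeps, for each action $a$, $$\overline V_{t,a}=\lambda I+\sum_{i\le t,\,a_i=a}x_ix_i^{\top},\qquad \hat\theta_{t,a}=\overline V_{t,a}^{-1}\sum_{i\le t,\,a_i=a}r_ix_i,$$ $$C_{t,a}=\Big\{\theta\in\mathbb R^d:\ \|\hat\theta_{t,a}-\theta\|_{\overline V_{t,a}}\le\sqrt{\beta_t(\delta)}\Big\},\qquad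 \sqrt{\beta_t(\delta)}=\sigma\sqrt{\max\{d,2\}\,\log\frac{K(1+tS_x^2/\lambda)}{\delta}}+\sqrt\lambda\,S_\theta,$$ where $\|v\|_V=\sqrt{v^\top Vv}$, and in round $t$ it plays an action $a_t$ for which some $(a_t,\tilde\theta_t)$ maximizes $\langle x_t,\theta\rangle$ over all pairs $(a,\theta)$ with $\theta\in C_{t-1,a}$ (ties broken arbitrarily). Let $\pi^*(x)\in\arg\max_a\langle x,\theta^*_a\rangle$ and let $R_T=\sum_{t=1}^T\big(\langle x_t,\theta^*_{\pi^*(x_t)}\rangle-\langle x_t,\theta^*_{a_t}\rangle\big)$ be the regret. Then, with probability at least $1-\delta$, the regret of mOFUL is $O(\sqrt{KT})$ up to the dependence on $d,\sigma,\lambda,S_x,S_\theta$ and logarithmic factors in $K$, $T$, $1/\delta$. Precisely, there is a universal constant $C>0$ such that for all values of the parameters, with probability at least $1-\delta$, $$R_T\le C\,\max\Big\{1,\frac{S_x}{\sqrt\lambda}\Big\}\,\sqrt{\beta_T(\delta)}\,\sqrt{d\,\log\Big(1+\frac{T S_x^2}{\lambda dK}\Big)}\;\sqrt{KT}.$$ 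-/

import Mathlib

open MeasureTheory
open scoped Matrix

noncomputable section

namespace MOFUL

/-- The space of contexts and of reward parameters: `ℝ^d` with its Euclidean norm. -/
abbrev Vec (d : ℕ) : Type := EuclideanSpace ℝ (Fin d)

section Algorithm

variable {d K : ℕ}

/-- The regularized design matrix of action `b` after the first `t` rounds (rounds are numbered
`0, 1, 2, …`): `λ I + ∑_{i < t, a_i = b} x_i x_iᵀ`. -/
def designMatrix (lam : ℝ) (x : ℕ → Vec d) (a : ℕ → Fin K) (t : ℕ) (b : Fin K) :
    Matrix (Fin d) (Fin d) ℝ :=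
  lam • (1 : Matrix (Fin d) (Fin d) ℝ) +
    ∑ i ∈ (Finset.range t).filter (fun i => a i = b),
      Matrix.vecMulVec (x i).ofLp (x i).ofLp

/-- The regularized least-squares estimate of the parameter of action `b` after `t` rounds,
`(Xᵀ X + λ I)⁻¹ Xᵀ Y`, where the rows of `X` are the contexts `x_i` and the entries of `Y` the
rewards `r_i` of the rounds `i < t` in which `b` was played. -/
def ridgeEstimate (lam : ℝ) (x : ℕ → Vec d) (a : ℕ → Fin K) (r : ℕ → ℝ) (t : ℕ) (b : Fin K) :
    Vec d :=
  WithLp.toLp 2 ((designMatrix lam x a t b)⁻¹ *ᵥ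
    ∑ i ∈ (Finset.range t).filter (fun i => a i = b), r i • (x i).ofLp)

/-- The weighted norm `‖v‖_V = √(vᵀ V v)`. -/
def weightedNorm (V : Matrix (Fin d) (Fin d) ℝ) (v : Vec d) : ℝ :=
  √(v.ofLp ⬝ᵥ (V *ᵥ v.ofLp))

/-- The radius `√β_t(δ)` of the confidence ellipsoids after `t` rounds. The factor `max d 2`
is `d` in every dimension `d ≥ 2`. -/
def radius (d K : ℕ) (σ lam Sx Sθ δ : ℝ) (t : ℕ) : ℝ :=
  σ * √((max d 2 : ℕ) * Real.log (K * (1 + t * Sx ^ 2 / lam) / δ)) + √lam * Sθ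

/-- The confidence ellipsoid of action `b` after `t` rounds. -/
def confidenceSet (σ lam Sx Sθ δ : ℝ) (x : ℕ → Vec d) (a : ℕ → Fin K) (r : ℕ → ℝ)
    (t : ℕ) (b : Fin K) : Set (Vec d) :=
  {θ | weightedNorm (designMatrix lam x a t b) (ridgeEstimate lam x a r t b - θ) ≤
    radius d K σ lam Sx Sθ δ t}

/-- The actions `a` are a possible output of the first `T` rounds of the algorithm on the contexts
`x` and the observed rewards `r`: in each round the pair of the action played and an optimistic
parameter `θt` of it maximizes `⟪x_t, θ⟫` over all actions `b` and all `θ` in the current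
confidence ellipsoid of `b`. Ties may be broken in any way. -/
def IsRun (σ lam Sx Sθ δ : ℝ) (T : ℕ) (x : ℕ → Vec d) (a : ℕ → Fin K) (r : ℕ → ℝ) : Prop :=
  ∀ t < T, ∃ θt ∈ confidenceSet σ lam Sx Sθ δ x a r t (a t),
    ∀ b : Fin K, ∀ θ ∈ confidenceSet σ lam Sx Sθ δ x a r t b,
      inner ℝ (x t) θ ≤ inner ℝ (x t) θt

/-- The regret `R_T` of the actions `a` against the policy `pol`, for the reward parameters
`θs`. -/
def regret (θs : Fin K → Vec d) (pol : Vec d → Fin K) (x : ℕ → Vec d) (a : ℕ → Fin K)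
    (T : ℕ) : ℝ :=
  ∑ t ∈ Finset.range T, (inner ℝ (x t) (θs (pol (x t))) - inner ℝ (x t) (θs (a t)))

end Algorithm

section Model

variable {Ω : Type*} [MeasurableSpace Ω] {d K : ℕ}

/-- `η` is `σ`-subgaussian conditionally on the sigma-algebra `m`:
`E[exp (s η) | m] ≤ exp (s² σ² / 2)` almost surely, for every real `s`. -/
def CondSubgaussian (μ : Measure Ω) (η : Ω → ℝ) (σ : ℝ) (m : MeasurableSpace Ω) : Prop :=
  ∀ s : ℝ, Integrable (fun ω => Real.exp (s * η ω)) μ ∧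
    ∀ᵐ ω ∂μ, (μ[fun ω => Real.exp (s * η ω) | m]) ω ≤ Real.exp (s ^ 2 * σ ^ 2 / 2)

/-- The information available when the reward of round `t` is about to be drawn: the contexts and
actions of the rounds `0, …, t` and the rewards of the rounds `0, …, t - 1`. -/
@[reducible] def history (x : ℕ → Ω → Vec d) (a : ℕ → Ω → Fin K) (r : ℕ → Ω → ℝ) (t : ℕ) :
    MeasurableSpace Ω :=
  (⨆ i ≤ t, MeasurableSpace.comap (x i) inferInstance) ⊔
  (⨆ i ≤ t, MeasurableSpace.comap (a i) inferInstance) ⊔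
  (⨆ i < t, MeasurableSpace.comap (r i) inferInstance)

/-- `T` rounds of interaction under the disjoint linear reward model with parameters `θs`:
contexts `x`, actions `a`, noise `η` and observed rewards `r`. -/
structure DisjointLinearModel (μ : Measure Ω) (T : ℕ) (σ : ℝ) (θs : Fin K → Vec d)
    (x : ℕ → Ω → Vec d) (a : ℕ → Ω → Fin K) (η r : ℕ → Ω → ℝ) : Prop where
  measurable_context : ∀ t < T, Measurable (x t)
  measurable_action : ∀ t < T, Measurable (a t)
  measurable_reward : ∀ t < T, Measurable (r t)
  reward_eq : ∀ t < T, ∀ ω, r t ω = inner ℝ (x t ω) (θs (a t ω)) + η t ω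
  subgaussian : ∀ t < T, CondSubgaussian μ (η t) σ (history x a r t)

end Model

end MOFUL

end

/-! Fix an action, with design matrix V and noise sum S = ∑ η_i x_i over its rounds. After scaling
to σ = 1, `potential`, i.e. exp((Sᵀ V⁻¹ S - log (det V / λ^d)) / 2), is a nonnegative
supermartingale started at 1. Indeed, by Sherman–Morrison and the matrix determinant lemma, its
one-step factor is the average of exp(z ξ - z² / 2) over a one-dimensional Gaussian z whose mean and
variance are known from the past, and for every past-measurable z that exponential has conditional
mean at most 1 (`CondSubgaussian.lintegral_mul_mixture_le`). The maximal inequality at level K / δ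
and a union bound over actions control every S at all times with probability at least 1 - δ. Since
θ̂ - θ* = V⁻¹ S - λ V⁻¹ θ*, every ellipsoid then contains its true parameter (`mem_confidenceSet`).

On that event optimism bounds the regret of a round by twice the radius times the V⁻¹-norm of the
context (`regret_le`). Cauchy–Schwarz passes to the sum of squared norms, which is bounded, up to a
constant, by the sum of the K log-determinants (`sum_log_one_add_eq`): T rounds against K
log-determinants yield √(KT). AM-GM on eigenvalues bounds each log-determinant, and Jensen across
the actions, which share the T contexts, puts K in the denominator inside the logarithm
(`sum_logDetRatio_le`). -/

namespace Matrix

/-! ### Quadratic forms and rank-one updates of positive definite matrices. -/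

variable {n : Type*}

lemma PosSemidef.isSymm {V : Matrix n n ℝ} (hV : V.PosSemidef) : V.IsSymm := by
  have h := hV.isHermitian.eq
  rwa [conjTranspose_eq_transpose_of_trivial] at h

variable [Fintype n]

lemma IsSymm.dotProduct_mulVec_comm {V : Matrix n n ℝ} (hV : V.IsSymm) (u v : n → ℝ) :
    u ⬝ᵥ (V *ᵥ v) = v ⬝ᵥ (V *ᵥ u) := by
  rw [dotProduct_mulVec, ← mulVec_transpose, hV.eq, dotProduct_comm]

lemma PosSemidef.quadForm_nonneg {V : Matrix n n ℝ} (hV : V.PosSemidef) (v : n → ℝ) :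
    0 ≤ v ⬝ᵥ (V *ᵥ v) := by
  simpa using hV.dotProduct_mulVec_nonneg v

lemma IsSymm.quadForm_add_smul {V : Matrix n n ℝ} (hV : V.IsSymm) (u v : n → ℝ) (c : ℝ) :
    (u + c • v) ⬝ᵥ (V *ᵥ (u + c • v)) =
      u ⬝ᵥ (V *ᵥ u) + 2 * c * (u ⬝ᵥ (V *ᵥ v)) + c ^ 2 * (v ⬝ᵥ (V *ᵥ v)) := by
  simp only [mulVec_add, mulVec_smul, dotProduct_add, add_dotProduct, smul_dotProduct,
    dotProduct_smul, smul_eq_mul]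
  rw [hV.dotProduct_mulVec_comm v u]
  ring

/-- The Cauchy–Schwarz inequality for a positive semidefinite form. -/
lemma PosSemidef.sq_dotProduct_mulVec_le {V : Matrix n n ℝ} (hV : V.PosSemidef) (u v : n → ℝ) :
    (u ⬝ᵥ (V *ᵥ v)) ^ 2 ≤ (u ⬝ᵥ (V *ᵥ u)) * (v ⬝ᵥ (V *ᵥ v)) := by
  have h : ∀ c : ℝ, 0 ≤ (v ⬝ᵥ (V *ᵥ v)) * (c * c) + (2 * (u ⬝ᵥ (V *ᵥ v))) * c
      + u ⬝ᵥ (V *ᵥ u) := by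
    intro c
    have := hV.quadForm_nonneg (u + c • v)
    rw [hV.isSymm.quadForm_add_smul] at this
    linarith
  have := discrim_le_zero h
  rw [discrim] at this
  linarith

lemma PosDef.add_vecMulVec_self {V : Matrix n n ℝ} (hV : V.PosDef) (x : n → ℝ) :
    (V + vecMulVec x x).PosDef :=
  hV.add_posSemidef (by simpa using posSemidef_vecMulVec_self_star x)

variable [DecidableEq n]

lemma PosDef.mul_inv_mulVec {V : Matrix n n ℝ} (hV : V.PosDef) (v : n → ℝ) :
    V *ᵥ (V⁻¹ *ᵥ v) = v := by
  rw [mulVec_mulVec, mul_nonsing_inv V (isUnit_iff_ne_zero.2 hV.det_pos.ne'), one_mulVec]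

lemma PosDef.inv_mul_mulVec {V : Matrix n n ℝ} (hV : V.PosDef) (v : n → ℝ) :
    V⁻¹ *ᵥ (V *ᵥ v) = v := by
  rw [mulVec_mulVec, nonsing_inv_mul V (isUnit_iff_ne_zero.2 hV.det_pos.ne'), one_mulVec]

/-- Cauchy–Schwarz for the V-form applied to V⁻¹u and v: the norms of V and V⁻¹ are dual. -/
lemma PosDef.sq_dotProduct_le {V : Matrix n n ℝ} (hV : V.PosDef) (u v : n → ℝ) :
    (u ⬝ᵥ v) ^ 2 ≤ (u ⬝ᵥ (V⁻¹ *ᵥ u)) * (v ⬝ᵥ (V *ᵥ v)) := by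
  have h := hV.posSemidef.sq_dotProduct_mulVec_le (V⁻¹ *ᵥ u) v
  rwa [hV.posSemidef.isSymm.dotProduct_mulVec_comm _ v, hV.mul_inv_mulVec, dotProduct_comm v u,
    dotProduct_comm _ u] at h

lemma PosDef.quadForm_inv_le {V : Matrix n n ℝ} (hV : V.PosDef) {lam : ℝ} (hlam : 0 < lam)
    (h : ∀ u, lam * (u ⬝ᵥ u) ≤ u ⬝ᵥ (V *ᵥ u)) (v : n → ℝ) :
    lam * (v ⬝ᵥ (V⁻¹ *ᵥ v)) ≤ v ⬝ᵥ v := by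
  set u := V⁻¹ *ᵥ v with hu
  have h1 := h u
  rw [hu, hV.mul_inv_mulVec, dotProduct_comm _ v, ← hu] at h1
  have h2 : (v ⬝ᵥ u) ^ 2 ≤ (v ⬝ᵥ v) * (u ⬝ᵥ u) := by
    simpa using (PosSemidef.one (n := n) (R := ℝ)).sq_dotProduct_mulVec_le v u
  have hvv : 0 ≤ v ⬝ᵥ v := by simpa using dotProduct_star_self_nonneg v
  have hq : 0 ≤ v ⬝ᵥ u := hV.posSemidef.inv.quadForm_nonneg v
  rcases hq.eq_or_lt with hq | hq
  · rw [← hq]; simpa using hvv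
  -- With u = V⁻¹v, lam (v·u)² ≤ lam ‖v‖² ‖u‖² ≤ ‖v‖² (v·u); one factor v·u cancels.
  · refine le_of_mul_le_mul_right ?_ hq
    nlinarith [mul_le_mul_of_nonneg_left h1 hvv]

lemma PosDef.det_add_vecMulVec_self {V : Matrix n n ℝ} (hV : V.PosDef) (x : n → ℝ) :
    (V + vecMulVec x x).det = V.det * (1 + x ⬝ᵥ (V⁻¹ *ᵥ x)) := by
  rw [vecMulVec_eq Unit, det_add_replicateCol_mul_replicateRow
    (isUnit_iff_ne_zero.2 hV.det_pos.ne'), det_unique (n := Unit)]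
  congr 2
  rw [Matrix.mul_assoc, ← replicateCol_mulVec]
  simp [mul_apply, dotProduct]

/-- The rank-one update of the quadratic form of the inverse (Sherman–Morrison). -/
lemma PosDef.quadForm_inv_add_vecMulVec_self {V : Matrix n n ℝ} (hV : V.PosDef) (x s : n → ℝ)
    (c : ℝ) :
    (s + c • x) ⬝ᵥ ((V + vecMulVec x x)⁻¹ *ᵥ (s + c • x)) =
      s ⬝ᵥ (V⁻¹ *ᵥ s) + (c ^ 2 * (x ⬝ᵥ (V⁻¹ *ᵥ x)) + 2 * c * (x ⬝ᵥ (V⁻¹ *ᵥ s))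
        - (x ⬝ᵥ (V⁻¹ *ᵥ s)) ^ 2) / (1 + x ⬝ᵥ (V⁻¹ *ᵥ x)) := by
  have hw := hV.posSemidef.inv.quadForm_nonneg x
  set w := x ⬝ᵥ (V⁻¹ *ᵥ x) with hw_def
  set b := x ⬝ᵥ (V⁻¹ *ᵥ s) with hb_def
  have hb' : s ⬝ᵥ (V⁻¹ *ᵥ x) = b := hV.posSemidef.inv.isSymm.dotProduct_mulVec_comm s x
  have h1w : 1 + w ≠ 0 := by positivity
  -- This e makes V⁻¹s + e V⁻¹x the solution of the updated linear system, so the updated inverse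
  -- never has to be written out.
  set e := (c - b) / (1 + w) with he
  have key : (V + vecMulVec x x) *ᵥ (V⁻¹ *ᵥ s + e • (V⁻¹ *ᵥ x)) = s + c • x := by
    rw [add_mulVec, mulVec_add, mulVec_smul, hV.mul_inv_mulVec, hV.mul_inv_mulVec,
      vecMulVec_mulVec, dotProduct_add, dotProduct_smul, ← hw_def, ← hb_def, add_assoc]
    congr 1
    rw [op_smul_eq_smul, ← add_smul]
    congr 1
    rw [smul_eq_mul, he]
    field_simp
    ring
  rw [← key, (hV.add_vecMulVec_self x).inv_mul_mulVec, key]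
  simp only [add_dotProduct, dotProduct_add, smul_dotProduct, dotProduct_smul, smul_eq_mul]
  rw [← hw_def, ← hb_def, hb', he]
  field_simp
  ring

/-- AM-GM for the eigenvalues, as Jensen's inequality for the logarithm with equal weights. -/
lemma PosDef.log_det_le {V : Matrix n n ℝ} (hV : V.PosDef) :
    Real.log V.det ≤ Fintype.card n * Real.log (V.trace / Fintype.card n) := by
  rcases isEmpty_or_nonempty n with hn | hn
  · simp
  have hpos := hV.eigenvalues_pos
  have hcard : (0 : ℝ) < Fintype.card n := by exact_mod_cast Fintype.card_pos
  have h := strictConcaveOn_log_Ioi.concaveOn.le_map_sum (t := Finset.univ)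
    (w := fun _ : n => (Fintype.card n : ℝ)⁻¹) (p := hV.isHermitian.eigenvalues)
    (fun _ _ => by positivity) (by simp) (fun i _ => hpos i)
  have ht : V.trace = ∑ i, hV.isHermitian.eigenvalues i := by
    simpa using hV.isHermitian.trace_eq_sum_eigenvalues
  have hd : V.det = ∏ i, hV.isHermitian.eigenvalues i := by
    simpa using hV.isHermitian.det_eq_prod_eigenvalues
  simp only [smul_eq_mul, ← Finset.mul_sum] at h
  rw [ht, hd, Real.log_prod (fun i _ => (hpos i).ne'), div_eq_inv_mul]
  rwa [inv_mul_le_iff₀ hcard] at h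

end Matrix

/-! ### Weighted norms, design matrices and log-determinants. -/

namespace MOFUL

variable {d K : ℕ}

lemma weightedNorm_add_le {V : Matrix (Fin d) (Fin d) ℝ} (hV : V.PosSemidef) (u v : Vec d) :
    weightedNorm V (u + v) ≤ weightedNorm V u + weightedNorm V v := by
  have h := hV.isSymm.quadForm_add_smul u.ofLp v.ofLp 1
  rw [one_smul] at h
  refine Real.sqrt_le_iff.2 ⟨by unfold weightedNorm; positivity, ?_⟩
  rw [WithLp.ofLp_add, h, add_sq, weightedNorm, weightedNorm,
    Real.sq_sqrt (hV.quadForm_nonneg _), Real.sq_sqrt (hV.quadForm_nonneg _)]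
  have := Real.abs_le_sqrt (hV.sq_dotProduct_mulVec_le u.ofLp v.ofLp)
  rw [Real.sqrt_mul (hV.quadForm_nonneg _)] at this
  linarith [le_abs_self (u.ofLp ⬝ᵥ V *ᵥ v.ofLp)]

lemma weightedNorm_neg (V : Matrix (Fin d) (Fin d) ℝ) (v : Vec d) :
    weightedNorm V (-v) = weightedNorm V v := by
  simp [weightedNorm, Matrix.mulVec_neg]

lemma weightedNorm_sub_le {V : Matrix (Fin d) (Fin d) ℝ} (hV : V.PosSemidef) (u v : Vec d) :
    weightedNorm V (u - v) ≤ weightedNorm V u + weightedNorm V v := by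
  rw [sub_eq_add_neg, ← weightedNorm_neg V v]
  exact weightedNorm_add_le hV u (-v)

lemma inner_le_weightedNorm {V : Matrix (Fin d) (Fin d) ℝ} (hV : V.PosDef) (x v : Vec d) :
    inner ℝ x v ≤ weightedNorm V⁻¹ x * weightedNorm V v := by
  rw [weightedNorm, weightedNorm, ← Real.sqrt_mul (hV.posSemidef.inv.quadForm_nonneg _)]
  refine (le_abs_self _).trans (Real.abs_le_sqrt ?_)
  refine le_trans (le_of_eq ?_) (hV.sq_dotProduct_le x.ofLp v.ofLp)
  simp [EuclideanSpace.inner_eq_star_dotProduct, dotProduct_comm]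

lemma dotProduct_self_ofLp (v : Vec d) : v.ofLp ⬝ᵥ v.ofLp = ‖v‖ ^ 2 := by
  rw [EuclideanSpace.real_norm_sq_eq]
  simp [dotProduct, sq]

/-- The context of round `t`, or `0` if another action than `b` is played. -/
def armContext (x : ℕ → Vec d) (a : ℕ → Fin K) (b : Fin K) (t : ℕ) : Fin d → ℝ :=
  if a t = b then (x t).ofLp else 0

lemma designMatrix_zero (lam : ℝ) (x : ℕ → Vec d) (a : ℕ → Fin K) (b : Fin K) :
    designMatrix lam x a 0 b = lam • 1 := by
  simp [designMatrix]

lemma designMatrix_succ (lam : ℝ) (x : ℕ → Vec d) (a : ℕ → Fin K) (t : ℕ) (b : Fin K) :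
    designMatrix lam x a (t + 1) b = designMatrix lam x a t b +
      Matrix.vecMulVec (armContext x a b t) (armContext x a b t) := by
  rw [designMatrix, designMatrix, Finset.range_add_one, Finset.filter_insert, armContext]
  split_ifs with h
  · rw [Finset.sum_insert (by simp)]
    abel
  · simp

lemma designMatrix_eq (lam : ℝ) (x : ℕ → Vec d) (a : ℕ → Fin K) (t : ℕ) (b : Fin K) :
    designMatrix lam x a t b = lam • 1 +
      ∑ i ∈ Finset.range t, Matrix.vecMulVec (armContext x a b i) (armContext x a b i) := by
  induction t with
  | zero => simp [designMatrix_zero]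
  | succ t ih => rw [designMatrix_succ, ih, Finset.sum_range_succ, add_assoc]

lemma designMatrix_posDef {lam : ℝ} (hlam : 0 < lam) (x : ℕ → Vec d) (a : ℕ → Fin K) (t : ℕ)
    (b : Fin K) : (designMatrix lam x a t b).PosDef := by
  induction t with
  | zero => rw [designMatrix_zero]; exact Matrix.PosDef.one.smul hlam
  | succ t ih => rw [designMatrix_succ]; exact ih.add_vecMulVec_self _

lemma designMatrix_quadForm_ge (lam : ℝ) (x : ℕ → Vec d) (a : ℕ → Fin K) (t : ℕ)
    (b : Fin K) (u : Fin d → ℝ) :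
    lam * (u ⬝ᵥ u) ≤ u ⬝ᵥ (designMatrix lam x a t b *ᵥ u) := by
  induction t with
  | zero => simp [designMatrix_zero, Matrix.smul_mulVec]
  | succ t ih =>
    rw [designMatrix_succ, Matrix.add_mulVec, dotProduct_add]
    have : (Matrix.vecMulVec (armContext x a b t) (armContext x a b t)).PosSemidef := by
      simpa using Matrix.posSemidef_vecMulVec_self_star (armContext x a b t)
    linarith [this.quadForm_nonneg u]

lemma quadForm_designMatrix_inv_le {lam : ℝ} (hlam : 0 < lam) (x : ℕ → Vec d) (a : ℕ → Fin K)
    (t : ℕ) (b : Fin K) (v : Fin d → ℝ) :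
    v ⬝ᵥ ((designMatrix lam x a t b)⁻¹ *ᵥ v) ≤ (v ⬝ᵥ v) / lam := by
  rw [le_div_iff₀' hlam]
  exact (designMatrix_posDef hlam x a t b).quadForm_inv_le hlam
    (designMatrix_quadForm_ge lam x a t b) v

lemma trace_designMatrix (lam : ℝ) (x : ℕ → Vec d) (a : ℕ → Fin K) (t : ℕ) (b : Fin K) :
    (designMatrix lam x a t b).trace =
      lam * d + ∑ i ∈ Finset.range t, if a i = b then ‖x i‖ ^ 2 else 0 := by
  rw [designMatrix_eq, Matrix.trace_add, Matrix.trace_sum]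
  congr 1
  · simp
  · refine Finset.sum_congr rfl fun i _ => ?_
    rw [Matrix.trace_vecMulVec, armContext]
    split_ifs
    · exact dotProduct_self_ofLp _
    · simp

/-- The log-determinant of the design matrix, normalized to be `0` before the first round. -/
noncomputable def logDetRatio (lam : ℝ) (x : ℕ → Vec d) (a : ℕ → Fin K) (t : ℕ) (b : Fin K) : ℝ :=
  Real.log ((designMatrix lam x a t b).det / lam ^ d)

lemma logDetRatio_zero {lam : ℝ} (hlam : 0 < lam) (x : ℕ → Vec d) (a : ℕ → Fin K) (b : Fin K) :
    logDetRatio lam x a 0 b = 0 := by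
  have : lam ^ d ≠ 0 := by positivity
  simp [logDetRatio, designMatrix_zero, this]

/-- The matrix determinant lemma; it drives both the potential and the telescoping sum in the
regret. -/
lemma logDetRatio_succ {lam : ℝ} (hlam : 0 < lam) (x : ℕ → Vec d) (a : ℕ → Fin K) (t : ℕ)
    (b : Fin K) :
    logDetRatio lam x a (t + 1) b = logDetRatio lam x a t b +
      Real.log (1 + armContext x a b t ⬝ᵥ
        ((designMatrix lam x a t b)⁻¹ *ᵥ armContext x a b t)) := by
  have hV := designMatrix_posDef hlam x a t b
  have := hV.posSemidef.inv.quadForm_nonneg (armContext x a b t)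
  have hd := hV.det_pos
  rw [logDetRatio, logDetRatio, designMatrix_succ, hV.det_add_vecMulVec_self, mul_div_right_comm,
    Real.log_mul (by positivity) (by positivity)]

lemma logDetRatio_le {lam : ℝ} (hlam : 0 < lam) (x : ℕ → Vec d) (a : ℕ → Fin K) (t : ℕ)
    (b : Fin K) :
    logDetRatio lam x a t b ≤ d * Real.log
      (1 + (∑ i ∈ Finset.range t, if a i = b then ‖x i‖ ^ 2 else 0) / (lam * d)) := by
  rcases Nat.eq_zero_or_pos d with rfl | hd
  · simp [logDetRatio]
  have hd' : (0 : ℝ) < d := by exact_mod_cast hd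
  have hV := designMatrix_posDef hlam x a t b
  have h := hV.log_det_le
  have hs : 0 ≤ ∑ i ∈ Finset.range t, if a i = b then ‖x i‖ ^ 2 else 0 :=
    Finset.sum_nonneg fun i _ => by split_ifs <;> positivity
  set s := ∑ i ∈ Finset.range t, if a i = b then ‖x i‖ ^ 2 else 0
  rw [trace_designMatrix, Fintype.card_fin] at h
  have e : (lam * d + s) / d = lam * (1 + s / (lam * d)) := by field_simp
  rw [e, Real.log_mul (by positivity) (by positivity)] at h
  rw [logDetRatio, Real.log_div hV.det_pos.ne' (by positivity), Real.log_pow]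
  linarith

/-! ### Exponential moments of conditionally subgaussian noise. -/

section CondSubgaussian

variable {Ω : Type*} {m m0 : MeasurableSpace Ω} {μ : Measure Ω}
  {η : Ω → ℝ} {σ : ℝ}

open ENNReal Filter Topology

lemma CondSubgaussian.div_const (hσ : σ ≠ 0) (h : CondSubgaussian μ η σ m) :
    CondSubgaussian μ (fun ω => η ω / σ) 1 m := by
  intro s
  have := h (s / σ)
  rw [div_pow, div_mul_cancel₀ _ (pow_ne_zero 2 hσ)] at this
  simpa only [div_mul_eq_mul_div, mul_div_assoc, one_pow, mul_one] using this

variable [IsProbabilityMeasure μ]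

lemma CondSubgaussian.setLIntegral_exp_const_le (hm : m ≤ m0) (h : CondSubgaussian μ η σ m)
    (z : ℝ) {A : Set Ω} (hA : MeasurableSet[m] A) :
    ∫⁻ ω in A, ENNReal.ofReal (Real.exp (z * η ω - z ^ 2 * σ ^ 2 / 2)) ∂μ ≤ μ A := by
  obtain ⟨hint, hle⟩ := h z
  have hc : 0 ≤ Real.exp (-(z ^ 2 * σ ^ 2 / 2)) := (Real.exp_pos _).le
  have h1 : ∫ ω in A, Real.exp (z * η ω) ∂μ ≤ μ.real A * Real.exp (z ^ 2 * σ ^ 2 / 2) := by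
    rw [← setIntegral_condExp hm hint hA, ← smul_eq_mul, ← setIntegral_const]
    exact integral_mono_ae integrable_condExp.integrableOn (integrable_const _)
      (ae_restrict_of_ae hle)
  simp_rw [sub_eq_add_neg, Real.exp_add]
  rw [← ofReal_integral_eq_lintegral_ofReal (hint.integrableOn.mul_const _)
    (Eventually.of_forall fun ω => by positivity), integral_mul_const,
    ← ofReal_measureReal (measure_ne_top μ A)]
  refine ENNReal.ofReal_le_ofReal ((mul_le_mul_of_nonneg_right h1 hc).trans (le_of_eq ?_))
  rw [mul_assoc, ← Real.exp_add, add_neg_cancel, Real.exp_zero, mul_one]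

/-- Subgaussianity is given for constant exponents only. For a finitely valued Z, split A along the
level sets of Z; approximate a general Z by `m`-simple functions and use Fatou. -/
lemma CondSubgaussian.setLIntegral_exp_le (hm : m ≤ m0) (h : CondSubgaussian μ η σ m)
    (hη : Measurable η) {Z : Ω → ℝ} (hZ : Measurable[m] Z) {A : Set Ω}
    (hA : MeasurableSet[m] A) :
    ∫⁻ ω in A, ENNReal.ofReal (Real.exp (Z ω * η ω - Z ω ^ 2 * σ ^ 2 / 2)) ∂μ ≤ μ A := by
  have hsimple : ∀ f : Ω → ℝ, Measurable[m] f → (Set.range f).Finite →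
      ∫⁻ ω in A, ENNReal.ofReal (Real.exp (f ω * η ω - f ω ^ 2 * σ ^ 2 / 2)) ∂μ ≤ μ A := by
    intro f hf hfin
    have hms : ∀ z, MeasurableSet[m] (A ∩ f ⁻¹' {z}) := fun z =>
      hA.inter (hf (measurableSet_singleton z))
    have hU : A = ⋃ z ∈ hfin.toFinset, A ∩ f ⁻¹' {z} := by
      ext ω
      simp
    have hdisj : Set.PairwiseDisjoint (hfin.toFinset : Set ℝ) (fun z => A ∩ f ⁻¹' {z}) := by
      intro y _ z _ hyz
      refine Set.disjoint_left.2 ?_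
      rintro ω ⟨_, h1⟩ ⟨_, h2⟩
      exact hyz (h1.symm.trans h2)
    have hμ : μ A = ∑ z ∈ hfin.toFinset, μ (A ∩ f ⁻¹' {z}) := by
      conv_lhs => rw [hU]
      exact measure_biUnion_finset hdisj fun z _ => hm _ (hms z)
    rw [hμ]
    conv_lhs => rw [hU]
    rw [lintegral_biUnion_finset hdisj (fun z _ => hm _ (hms z))]
    refine Finset.sum_le_sum fun z _ => ?_
    rw [setLIntegral_congr_fun (hm _ (hms z)) (g := fun ω =>
      ENNReal.ofReal (Real.exp (z * η ω - z ^ 2 * σ ^ 2 / 2)))]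
    · exact h.setLIntegral_exp_const_le hm z (hms z)
    · rintro ω ⟨_, h2⟩
      have : f ω = z := h2
      simp only [this]
  have hZs : StronglyMeasurable[m] Z := hZ.stronglyMeasurable
  have hlim : ∀ ω, Tendsto (fun n => ENNReal.ofReal
      (Real.exp (hZs.approx n ω * η ω - hZs.approx n ω ^ 2 * σ ^ 2 / 2))) atTop
      (𝓝 (ENNReal.ofReal (Real.exp (Z ω * η ω - Z ω ^ 2 * σ ^ 2 / 2)))) := by
    intro ω
    have hc : Continuous fun z : ℝ =>
        ENNReal.ofReal (Real.exp (z * η ω - z ^ 2 * σ ^ 2 / 2)) :=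
      ENNReal.continuous_ofReal.comp (by fun_prop)
    exact (hc.tendsto _).comp (hZs.tendsto_approx ω)
  calc
    _ = ∫⁻ ω in A, liminf (fun n => ENNReal.ofReal
        (Real.exp (hZs.approx n ω * η ω - hZs.approx n ω ^ 2 * σ ^ 2 / 2))) atTop ∂μ :=
      lintegral_congr fun ω => (hlim ω).liminf_eq.symm
    _ ≤ liminf (fun n => ∫⁻ ω in A, ENNReal.ofReal
        (Real.exp (hZs.approx n ω * η ω - hZs.approx n ω ^ 2 * σ ^ 2 / 2)) ∂μ) atTop := by
      refine lintegral_liminf_le fun n => ?_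
      have : Measurable (hZs.approx n) := (@SimpleFunc.measurable Ω ℝ m _ (hZs.approx n)).mono hm le_rfl
      fun_prop
    _ ≤ μ A := liminf_le_of_le (by isBoundedDefault) fun c hc => by
      obtain ⟨n, hn⟩ := hc.exists
      exact hn.trans (hsimple _ (@SimpleFunc.measurable Ω ℝ m _ _)
        (@SimpleFunc.finite_range Ω ℝ m _))

lemma CondSubgaussian.lintegral_mul_exp_le (hm : m ≤ m0) (h : CondSubgaussian μ η σ m)
    (hη : Measurable η) {Z : Ω → ℝ} (hZ : Measurable[m] Z) {F : Ω → ℝ≥0∞}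
    (hF : Measurable[m] F) :
    ∫⁻ ω, F ω * ENNReal.ofReal (Real.exp (Z ω * η ω - Z ω ^ 2 * σ ^ 2 / 2)) ∂μ ≤
      ∫⁻ ω, F ω ∂μ := by
  have hZ' : Measurable Z := hZ.mono hm le_rfl
  have hE : Measurable fun ω =>
      ENNReal.ofReal (Real.exp (Z ω * η ω - Z ω ^ 2 * σ ^ 2 / 2)) := by fun_prop
  -- The bound on all `m`-measurable sets is an inequality of measures on `m`, which can be
  -- integrated against any `m`-measurable F.
  have hle : (μ.withDensity fun ω =>
      ENNReal.ofReal (Real.exp (Z ω * η ω - Z ω ^ 2 * σ ^ 2 / 2))).trim hm ≤ μ.trim hm := by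
    refine Measure.le_intro fun s hs _ => ?_
    rw [trim_measurableSet_eq hm hs, trim_measurableSet_eq hm hs, withDensity_apply _ (hm _ hs)]
    exact h.setLIntegral_exp_le hm hη hZ hs
  have := lintegral_mono' hle (le_refl F)
  rw [lintegral_trim hm hF, lintegral_trim hm hF,
    lintegral_withDensity_eq_lintegral_mul _ hE (hF.mono hm le_rfl)] at this
  simpa only [Pi.mul_apply, mul_comm] using this

lemma lintegral_ofReal_exp_neg_sq {c : ℝ} (hc : 0 < c) (k : ℝ) :
    ∫⁻ g : ℝ, ENNReal.ofReal (Real.exp (-c * (g - k) ^ 2)) =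
      ENNReal.ofReal √(Real.pi / c) := by
  rw [lintegral_sub_right_eq_self (fun g : ℝ => ENNReal.ofReal (Real.exp (-c * g ^ 2))) k,
    ← integral_gaussian, ofReal_integral_eq_lintegral_ofReal (integrable_exp_neg_mul_sq hc)
      (Eventually.of_forall fun _ => by positivity)]

/-- The exponential of `y z - z² / 2`, averaged over a Gaussian `z` of mean `b` and
variance `w`. -/
lemma lintegral_exp_gaussian_mixture {w : ℝ} (hw : 0 ≤ w) (b y : ℝ) :
    ∫⁻ g : ℝ, ENNReal.ofReal (Real.exp (-(1 / 2) * (g - 0) ^ 2)) *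
        ENNReal.ofReal (Real.exp ((b + √w * g) * y - (b + √w * g) ^ 2 * 1 ^ 2 / 2)) =
      ENNReal.ofReal √(Real.pi / (1 / 2)) * ENNReal.ofReal ((√(1 + w))⁻¹ *
        Real.exp ((y ^ 2 * w + 2 * y * b - b ^ 2) / (1 + w) / 2)) := by
  have h1w : 0 < 1 + w := by positivity
  have hs : √w ^ 2 = w := Real.sq_sqrt hw
  -- Complete the square in g. The shapes `g - 0` and `1 ^ 2` match the Gaussian integral with
  -- centre 0 and the exponential bound with σ = 1.
  have key : ∀ g : ℝ, ENNReal.ofReal (Real.exp (-(1 / 2) * (g - 0) ^ 2)) *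
        ENNReal.ofReal (Real.exp ((b + √w * g) * y - (b + √w * g) ^ 2 * 1 ^ 2 / 2)) =
      ENNReal.ofReal (Real.exp ((y ^ 2 * w + 2 * y * b - b ^ 2) / (1 + w) / 2)) *
      ENNReal.ofReal (Real.exp (-((1 + w) / 2) * (g - √w * (y - b) / (1 + w)) ^ 2)) := by
    intro g
    rw [← ENNReal.ofReal_mul (by positivity), ← ENNReal.ofReal_mul (by positivity),
      ← Real.exp_add, ← Real.exp_add]
    congr 2
    field_simp
    ring_nf
    rw [hs]
    ring
  simp_rw [key]
  rw [lintegral_const_mul _ (by fun_prop), lintegral_ofReal_exp_neg_sq (by positivity),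
    ← ENNReal.ofReal_mul (by positivity), ← ENNReal.ofReal_mul (by positivity)]
  congr 1
  rw [show Real.pi / ((1 + w) / 2) = (Real.pi / (1 / 2)) / (1 + w) by field_simp,
    Real.sqrt_div (by positivity)]
  ring

/-- The supermartingale step: the factor is a Gaussian average over z = b + √w g, and by Tonelli the
bound for each fixed g, where z is `m`-measurable, carries over to the average. -/
lemma CondSubgaussian.lintegral_mul_mixture_le (hm : m ≤ m0) (h : CondSubgaussian μ η 1 m)
    (hη : Measurable η) {b w : Ω → ℝ} (hb : Measurable[m] b) (hw : Measurable[m] w)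
    (hw0 : ∀ ω, 0 ≤ w ω) {F : Ω → ℝ≥0∞} (hF : Measurable[m] F) :
    ∫⁻ ω, F ω * ENNReal.ofReal ((√(1 + w ω))⁻¹ *
      Real.exp ((η ω ^ 2 * w ω + 2 * η ω * b ω - b ω ^ 2) / (1 + w ω) / 2)) ∂μ ≤
      ∫⁻ ω, F ω ∂μ := by
  have hb' : Measurable b := hb.mono hm le_rfl
  have hw' : Measurable w := hw.mono hm le_rfl
  have hF' : Measurable F := hF.mono hm le_rfl
  have hpos : ENNReal.ofReal √(Real.pi / (1 / 2)) ≠ 0 := by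
    have := Real.pi_pos
    rw [ENNReal.ofReal_ne_zero_iff]
    positivity
  -- Multiplying through by √(2π) keeps the Gaussian weight unnormalized.
  rw [← ENNReal.mul_le_mul_iff_right hpos ENNReal.ofReal_ne_top]
  calc
    _ = ∫⁻ ω, ∫⁻ g : ℝ, F ω * (ENNReal.ofReal (Real.exp (-(1 / 2) * (g - 0) ^ 2)) *
        ENNReal.ofReal (Real.exp ((b ω + √(w ω) * g) * η ω -
          (b ω + √(w ω) * g) ^ 2 * 1 ^ 2 / 2))) ∂(volume : Measure ℝ) ∂μ := by
      rw [← lintegral_const_mul _ (by fun_prop)]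
      refine lintegral_congr fun ω => ?_
      rw [lintegral_const_mul _ (by fun_prop), lintegral_exp_gaussian_mixture (hw0 ω)]
      ring
    _ = ∫⁻ g : ℝ, ∫⁻ ω, F ω * (ENNReal.ofReal (Real.exp (-(1 / 2) * (g - 0) ^ 2)) *
        ENNReal.ofReal (Real.exp ((b ω + √(w ω) * g) * η ω -
          (b ω + √(w ω) * g) ^ 2 * 1 ^ 2 / 2))) ∂μ :=
      lintegral_lintegral_swap (by fun_prop)
    _ ≤ ∫⁻ g : ℝ, ENNReal.ofReal (Real.exp (-(1 / 2) * (g - 0) ^ 2)) * ∫⁻ ω, F ω ∂μ := by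
      refine lintegral_mono fun g => ?_
      have hZ : Measurable[m] fun ω => b ω + √(w ω) * g :=
        hb.add ((Real.continuous_sqrt.measurable.comp hw).mul_const g)
      simp_rw [mul_left_comm (F _)]
      rw [lintegral_const_mul _ (by fun_prop)]
      exact mul_le_mul_right (h.lintegral_mul_exp_le hm hη hZ hF) _
    _ = _ := by
      rw [lintegral_mul_const _ (by fun_prop), lintegral_ofReal_exp_neg_sq (by norm_num)]

/-- The function e^y + e^(-y) - 2 is nonnegative, vanishes only at y = 0, and here has integral at
most 0. -/
lemma CondSubgaussian.ae_eq_zero (hm : m ≤ m0) (h : CondSubgaussian μ η 0 m) :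
    ∀ᵐ ω ∂μ, η ω = 0 := by
  have hle : ∀ s : ℝ, ∫ ω, Real.exp (s * η ω) ∂μ ≤ 1 := by
    intro s
    obtain ⟨_, h2⟩ := h s
    rw [← integral_condExp hm]
    refine (integral_mono_ae integrable_condExp (integrable_const 1) ?_).trans (by simp)
    filter_upwards [h2] with ω hω
    simpa using hω
  have hpos : ∀ y : ℝ, 0 ≤ Real.exp (1 * y) + Real.exp (-1 * y) - 2 := fun y => by
    linarith [Real.add_one_le_exp (1 * y), Real.add_one_le_exp (-1 * y)]
  have hi := ((h 1).1.add (h (-1)).1).sub (integrable_const (2 : ℝ))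
  have h0 : ∫ ω, Real.exp (1 * η ω) + Real.exp (-1 * η ω) - 2 ∂μ = 0 := by
    refine le_antisymm ?_ (integral_nonneg fun ω => hpos _)
    have e : ∫ ω, Real.exp (1 * η ω) + Real.exp (-1 * η ω) - 2 ∂μ =
        ∫ ω, Real.exp (1 * η ω) ∂μ + ∫ ω, Real.exp (-1 * η ω) ∂μ - ∫ _, (2 : ℝ) ∂μ := by
      rw [← integral_add (h 1).1 (h (-1)).1]
      exact integral_sub ((h 1).1.add (h (-1)).1) (integrable_const _)
    rw [e]
    have := hle 1
    have := hle (-1)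
    simp only [integral_const, probReal_univ, one_smul]
    linarith
  rw [integral_eq_zero_iff_of_nonneg (fun ω => hpos _) hi] at h0
  filter_upwards [h0] with ω hω
  by_contra hne
  have h1 := Real.add_one_lt_exp (x := 1 * η ω) (by simpa using hne)
  have h2 := Real.add_one_lt_exp (x := -1 * η ω) (by simpa using hne)
  simp only [Pi.zero_apply] at hω
  linarith

end CondSubgaussian

/-! ### The mixture potential of one action. -/

section Potential

variable {d K : ℕ}

/-- The sum of the noise-weighted contexts of action `b` over the first `t` rounds. -/
def noiseSum (x : ℕ → Vec d) (a : ℕ → Fin K) (η : ℕ → ℝ) (t : ℕ) (b : Fin K) : Fin d → ℝ :=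
  ∑ i ∈ Finset.range t, η i • armContext x a b i

/-- The Gaussian mixture of the likelihood ratios of action `b` after `t` rounds. -/
noncomputable def potential (lam : ℝ) (x : ℕ → Vec d) (a : ℕ → Fin K) (ξ : ℕ → ℝ) (t : ℕ)
    (b : Fin K) : ℝ :=
  Real.exp ((noiseSum x a ξ t b ⬝ᵥ ((designMatrix lam x a t b)⁻¹ *ᵥ noiseSum x a ξ t b)
    - logDetRatio lam x a t b) / 2)

lemma potential_zero {lam : ℝ} (hlam : 0 < lam) (x : ℕ → Vec d) (a : ℕ → Fin K) (ξ : ℕ → ℝ)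
    (b : Fin K) : potential lam x a ξ 0 b = 1 := by
  simp [potential, noiseSum, logDetRatio_zero hlam]

/-- Puts the update in the form of the Gaussian average with mean xᵀV⁻¹S and variance xᵀV⁻¹x. If
another action is played, `armContext` is 0 and the factor is 1. -/
lemma potential_succ {lam : ℝ} (hlam : 0 < lam) (x : ℕ → Vec d) (a : ℕ → Fin K) (ξ : ℕ → ℝ)
    (t : ℕ) (b : Fin K) :
    potential lam x a ξ (t + 1) b = potential lam x a ξ t b *
      ((√(1 + armContext x a b t ⬝ᵥ
          ((designMatrix lam x a t b)⁻¹ *ᵥ armContext x a b t)))⁻¹ *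
        Real.exp ((ξ t ^ 2 * (armContext x a b t ⬝ᵥ
            ((designMatrix lam x a t b)⁻¹ *ᵥ armContext x a b t)) +
          2 * ξ t * (armContext x a b t ⬝ᵥ
            ((designMatrix lam x a t b)⁻¹ *ᵥ noiseSum x a ξ t b)) -
          (armContext x a b t ⬝ᵥ
            ((designMatrix lam x a t b)⁻¹ *ᵥ noiseSum x a ξ t b)) ^ 2) /
          (1 + armContext x a b t ⬝ᵥ
            ((designMatrix lam x a t b)⁻¹ *ᵥ armContext x a b t)) / 2)) := by
  have hV := designMatrix_posDef hlam x a t b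
  have hw := hV.posSemidef.inv.quadForm_nonneg (armContext x a b t)
  have hS : noiseSum x a ξ (t + 1) b = noiseSum x a ξ t b + ξ t • armContext x a b t :=
    Finset.sum_range_succ _ _
  rw [potential, potential, hS, designMatrix_succ, logDetRatio_succ hlam,
    hV.quadForm_inv_add_vecMulVec_self]
  set w := armContext x a b t ⬝ᵥ ((designMatrix lam x a t b)⁻¹ *ᵥ armContext x a b t)
  have hsqrt : (√(1 + w))⁻¹ = Real.exp (-(Real.log (1 + w) / 2)) := by
    rw [Real.exp_neg, ← Real.log_sqrt (by positivity), Real.exp_log (by positivity)]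
  rw [hsqrt, ← Real.exp_add, ← Real.exp_add]
  congr 1
  ring

end Potential

/-! ### Measurability of the potential with respect to the past. -/

section Measurability

variable {Ω : Type*} {m : MeasurableSpace Ω} {d K : ℕ}

lemma measurable_det {n : Type*} [Fintype n] [DecidableEq n] {V : Ω → Matrix n n ℝ}
    (hV : ∀ i j, Measurable fun ω => V ω i j) : Measurable fun ω => (V ω).det := by
  simp_rw [Matrix.det_apply]
  refine Finset.measurable_sum _ fun σ _ => ?_
  exact (Finset.measurable_prod _ fun i _ => hV _ _).const_smul _

lemma measurable_inv_apply {n : Type*} [Fintype n] [DecidableEq n] {V : Ω → Matrix n n ℝ}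
    (hV : ∀ i j, Measurable fun ω => V ω i j) (i j : n) :
    Measurable fun ω => (V ω)⁻¹ i j := by
  simp_rw [Matrix.inv_def, Matrix.smul_apply, Ring.inverse_eq_inv', Matrix.adjugate_apply,
    smul_eq_mul]
  refine (measurable_det hV).inv.mul (measurable_det fun k l => ?_)
  simp_rw [Matrix.updateRow_apply]
  split_ifs
  · exact measurable_const
  · exact hV _ _

lemma measurable_dotProduct_mulVec {n : Type*} [Fintype n] {V : Ω → Matrix n n ℝ}
    (hV : ∀ i j, Measurable fun ω => V ω i j) {u v : Ω → n → ℝ} (hu : Measurable u)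
    (hv : Measurable v) : Measurable fun ω => u ω ⬝ᵥ (V ω *ᵥ v ω) := by
  simp only [dotProduct, Matrix.mulVec]
  fun_prop

lemma measurable_sub_inner (θs : Fin K → Vec d) {x : Ω → Vec d} {a : Ω → Fin K} {r : Ω → ℝ}
    (hx : Measurable x) (ha : Measurable a) (hr : Measurable r) :
    Measurable fun ω => r ω - inner ℝ (x ω) (θs (a ω)) :=
  hr.sub (hx.inner ((measurable_of_countable θs).comp ha))

variable {x : ℕ → Ω → Vec d} {a : ℕ → Ω → Fin K} {ξ : ℕ → Ω → ℝ} {t : ℕ} (lam : ℝ) (b : Fin K)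

lemma measurable_armContext (hx : Measurable (x t)) (ha : Measurable (a t)) :
    Measurable fun ω => armContext (fun i => x i ω) (fun i => a i ω) b t := by
  unfold armContext
  refine Measurable.ite (ha (measurableSet_singleton b)) ?_ measurable_const
  exact (WithLp.measurable_ofLp 2 _).comp hx

lemma measurable_designMatrix (hx : ∀ i < t, Measurable (x i)) (ha : ∀ i < t, Measurable (a i))
    (j k : Fin d) :
    Measurable fun ω => designMatrix lam (fun i => x i ω) (fun i => a i ω) t b j k := by
  simp_rw [designMatrix_eq, Matrix.add_apply, Matrix.sum_apply, Matrix.vecMulVec_apply]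
  refine measurable_const.add (Finset.measurable_sum _ fun i hi => ?_)
  have := measurable_armContext b (hx i (Finset.mem_range.1 hi)) (ha i (Finset.mem_range.1 hi))
  fun_prop

lemma measurable_noiseSum (hx : ∀ i < t, Measurable (x i)) (ha : ∀ i < t, Measurable (a i))
    (hξ : ∀ i < t, Measurable (ξ i)) :
    Measurable fun ω => noiseSum (fun i => x i ω) (fun i => a i ω) (fun i => ξ i ω) t b := by
  unfold noiseSum
  refine Finset.measurable_sum _ fun i hi => ?_
  have h := Finset.mem_range.1 hi
  exact (hξ i h).smul (measurable_armContext b (hx i h) (ha i h))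

lemma measurable_potential (hx : ∀ i < t, Measurable (x i)) (ha : ∀ i < t, Measurable (a i))
    (hξ : ∀ i < t, Measurable (ξ i)) :
    Measurable fun ω =>
      potential lam (fun i => x i ω) (fun i => a i ω) (fun i => ξ i ω) t b := by
  have hV := measurable_designMatrix lam b hx ha
  have hS := measurable_noiseSum b hx ha hξ
  have h1 := measurable_dotProduct_mulVec (measurable_inv_apply hV) hS hS
  have h2 := measurable_det hV
  unfold potential logDetRatio
  fun_prop

end Measurability

/-! ### Ville's maximal inequality without stopping times. -/

section MaximalInequality

open ENNReal

variable {Ω : Type*} [m0 : MeasurableSpace Ω] {μ : Measure Ω} [IsProbabilityMeasure μ]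
  {d K T : ℕ} {x : ℕ → Ω → Vec d} {a : ℕ → Ω → Fin K} {ξ : ℕ → Ω → ℝ}
  {ℱ : ℕ → MeasurableSpace Ω} {lam : ℝ}

/-- The inductive form of the maximal inequality of the supermartingale `potential`. -/
lemma mul_measure_exists_potential_gt_add_le (hlam : 0 < lam) (b : Fin K)
    (hle : ∀ t < T, ℱ t ≤ m0)
    (hx : ∀ t < T, ∀ i ≤ t, Measurable[ℱ t] (x i))
    (ha : ∀ t < T, ∀ i ≤ t, Measurable[ℱ t] (a i))
    (hξ : ∀ t < T, ∀ i < t, Measurable[ℱ t] (ξ i))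
    (hξ' : ∀ t < T, Measurable (ξ t))
    (hsub : ∀ t < T, CondSubgaussian μ (ξ t) 1 (ℱ t)) (c : ℝ) (t : ℕ) (ht : t < T) :
    let M : ℕ → Ω → ℝ := fun i ω =>
      potential lam (fun i => x i ω) (fun i => a i ω) (fun i => ξ i ω) i b
    ENNReal.ofReal c * μ {ω | ∃ i ≤ t, c < M i ω} +
      ∫⁻ ω in {ω | ∃ i ≤ t, c < M i ω}ᶜ, ENNReal.ofReal (M t ω) ∂μ ≤ 1 := by
  intro M
  have hM : ∀ t < T, ∀ i ≤ t, Measurable[ℱ t] (M i) := fun t ht i hi =>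
    measurable_potential lam b (fun j hj => hx t ht j (by omega))
      (fun j hj => ha t ht j (by omega)) (fun j hj => hξ t ht j (by omega))
  have hB : ∀ t < T, MeasurableSet[ℱ t] {ω | ∃ i ≤ t, c < M i ω} := by
    intro t ht
    have : {ω | ∃ i ≤ t, c < M i ω} = ⋃ i ∈ Set.Iic t, {ω | c < M i ω} := by ext; simp
    rw [this]
    exact MeasurableSet.biUnion (Set.to_countable _) fun i hi =>
      hM t ht i hi measurableSet_Ioi
  induction t with
  | zero =>
    have h0 : ∀ ω, M 0 ω = 1 := fun ω => potential_zero hlam _ _ _ b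
    simp only [h0, ENNReal.ofReal_one, setLIntegral_one]
    by_cases hc : c < 1
    · have : {ω : Ω | ∃ i ≤ 0, c < M i ω} = Set.univ := by
        ext ω; simpa [h0] using hc
      rw [this]
      simpa using hc.le
    · have : {ω : Ω | ∃ i ≤ 0, c < M i ω} = ∅ := by
        ext ω; simpa [h0] using hc
      rw [this]
      simp
  | succ t ih =>
    have ht' : t < T := by omega
    refine le_trans ?_ (ih ht')
    have hm1 : MeasurableSet {ω | ∃ i ≤ t, c < M i ω} := hle t ht' _ (hB t ht')
    have hm2 : MeasurableSet {ω | ∃ i ≤ t + 1, c < M i ω} := hle _ ht _ (hB _ ht)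
    have hBt := hB t ht'
    set A := {ω | ∃ i ≤ t, c < M i ω}
    set A' := {ω | ∃ i ≤ t + 1, c < M i ω}
    have hsubset : A ⊆ A' := fun ω ⟨i, hi, h⟩ => ⟨i, by omega, h⟩
    have hstep : ∫⁻ ω in Aᶜ, ENNReal.ofReal (M (t + 1) ω) ∂μ ≤
        ∫⁻ ω in Aᶜ, ENNReal.ofReal (M t ω) ∂μ := by
      rw [← lintegral_indicator hm1.compl, ← lintegral_indicator hm1.compl]
      have hV := measurable_designMatrix (m := ℱ t) lam b
        (fun i hi => hx t ht' i (le_of_lt hi)) (fun i hi => ha t ht' i (le_of_lt hi))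
      have hS := measurable_noiseSum (m := ℱ t) b (fun i hi => hx t ht' i (le_of_lt hi))
        (fun i hi => ha t ht' i (le_of_lt hi)) (fun i hi => hξ t ht' i hi)
      have hy := measurable_armContext (m := ℱ t) b (hx t ht' t le_rfl) (ha t ht' t le_rfl)
      -- Having not crossed by time t is a past event, so its indicator can be absorbed into the
      -- weight of the one-step bound.
      have hF : Measurable[ℱ t] (Aᶜ.indicator fun ω => ENNReal.ofReal (M t ω)) :=
        Measurable.indicator (ENNReal.measurable_ofReal.comp (hM t ht' t le_rfl)) hBt.compl
      refine le_trans (le_of_eq (lintegral_congr fun ω => ?_))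
        ((hsub t ht').lintegral_mul_mixture_le (hle t ht') (hξ' t ht')
        (measurable_dotProduct_mulVec (m := ℱ t) (measurable_inv_apply (m := ℱ t) hV) hy hS)
        (measurable_dotProduct_mulVec (m := ℱ t) (measurable_inv_apply (m := ℱ t) hV) hy hy)
        (fun ω => (designMatrix_posDef hlam _ _ t b).posSemidef.inv.quadForm_nonneg _) hF)
      by_cases hω : ω ∈ Aᶜ
      · rw [Set.indicator_of_mem hω, Set.indicator_of_mem hω,
          ← ENNReal.ofReal_mul (show 0 ≤ M t ω from (Real.exp_pos _).le)]
        exact congrArg _ (potential_succ hlam _ _ _ t b)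
      · rw [Set.indicator_of_notMem hω, Set.indicator_of_notMem hω, zero_mul]
    -- On A' \ A the first crossing is at time t + 1, so there M (t + 1) exceeds c and pays for the
    -- newly crossed mass.
    have hsplit : ENNReal.ofReal c * μ (A' \ A) +
        ∫⁻ ω in A'ᶜ, ENNReal.ofReal (M (t + 1) ω) ∂μ ≤
          ∫⁻ ω in Aᶜ, ENNReal.ofReal (M (t + 1) ω) ∂μ := by
      have hunion : Aᶜ = (A' \ A) ∪ A'ᶜ := by
        ext ω
        have := @hsubset ω
        simp only [Set.mem_compl_iff, Set.mem_union, Set.mem_sdiff]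
        tauto
      rw [hunion, lintegral_union hm2.compl
        (disjoint_compl_right.mono_left Set.sdiff_subset)]
      gcongr
      rw [← setLIntegral_const]
      refine setLIntegral_mono' (hm2.diff hm1) fun ω hω => ?_
      obtain ⟨⟨i, hi, hc⟩, hnot⟩ := hω
      have : i = t + 1 := by
        by_contra hne
        exact hnot ⟨i, by omega, hc⟩
      subst this
      exact ENNReal.ofReal_le_ofReal hc.le
    rw [← Set.union_sdiff_cancel hsubset, measure_union disjoint_sdiff_self_right (hm2.diff hm1),
      Set.union_sdiff_cancel hsubset, mul_add, add_assoc]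
    gcongr
    exact hsplit.trans hstep

lemma measure_exists_potential_gt_le (hlam : 0 < lam) (b : Fin K)
    (hle : ∀ t < T, ℱ t ≤ m0)
    (hx : ∀ t < T, ∀ i ≤ t, Measurable[ℱ t] (x i))
    (ha : ∀ t < T, ∀ i ≤ t, Measurable[ℱ t] (a i))
    (hξ : ∀ t < T, ∀ i < t, Measurable[ℱ t] (ξ i))
    (hξ' : ∀ t < T, Measurable (ξ t))
    (hsub : ∀ t < T, CondSubgaussian μ (ξ t) 1 (ℱ t)) {p : ℝ} (hp : 0 < p) :
    μ {ω | ∃ t < T, p⁻¹ <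
      potential lam (fun i => x i ω) (fun i => a i ω) (fun i => ξ i ω) t b} ≤
        ENNReal.ofReal p := by
  cases T with
  | zero => simp
  | succ t =>
    have h := le_self_add.trans (mul_measure_exists_potential_gt_add_le hlam b hle hx ha hξ hξ'
      hsub p⁻¹ t (Nat.lt_succ_self t))
    simp only [Nat.lt_succ_iff]
    rw [ENNReal.ofReal_inv_of_pos hp, mul_comm, ← div_eq_mul_inv] at h
    rw [ENNReal.div_le_iff (by simpa using hp) ENNReal.ofReal_ne_top, one_mul] at h
    exact h

end MaximalInequality

/-! ### Self-normalized concentration of the noise. -/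

section Confidence

variable {Ω : Type*} [m0 : MeasurableSpace Ω] {μ : Measure Ω} [IsProbabilityMeasure μ]
  {d K T : ℕ} {σ lam : ℝ} {θs : Fin K → Vec d}
  {x : ℕ → Ω → Vec d} {a : ℕ → Ω → Fin K} {η r : ℕ → Ω → ℝ}

lemma noiseSum_div (x : ℕ → Vec d) (a : ℕ → Fin K) (η : ℕ → ℝ) (σ : ℝ) (t : ℕ) (b : Fin K) :
    noiseSum x a (fun i => η i / σ) t b = σ⁻¹ • noiseSum x a η t b := by
  simp_rw [noiseSum, Finset.smul_sum, smul_smul, div_eq_inv_mul]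

/-- The self-normalized tail bound for the noise of one action. -/
theorem DisjointLinearModel.measure_exists_noiseSum_gt_le
    (h : DisjointLinearModel μ T σ θs x a η r) (hσ : 0 ≤ σ) (hlam : 0 < lam) (b : Fin K)
    {p : ℝ} (hp : 0 < p) :
    μ {ω | ∃ t < T, σ ^ 2 * (2 * Real.log p⁻¹ +
        logDetRatio lam (fun i => x i ω) (fun i => a i ω) t b) <
      noiseSum (fun i => x i ω) (fun i => a i ω) (fun i => η i ω) t b ⬝ᵥ
        ((designMatrix lam (fun i => x i ω) (fun i => a i ω) t b)⁻¹ *ᵥ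
          noiseSum (fun i => x i ω) (fun i => a i ω) (fun i => η i ω) t b)} ≤
        ENNReal.ofReal p := by
  have hle : ∀ t < T, history x a r t ≤ m0 := by
    intro t ht
    refine sup_le (sup_le ?_ ?_) ?_
    · exact iSup₂_le fun i hi => (h.measurable_context i (by omega)).comap_le
    · exact iSup₂_le fun i hi => (h.measurable_action i (by omega)).comap_le
    · exact iSup₂_le fun i hi => (h.measurable_reward i (by omega)).comap_le
  -- Dividing the noise by σ needs σ > 0. For σ = 0 the noise vanishes almost surely, so the strict
  -- inequality fails almost surely.
  rcases hσ.eq_or_lt with rfl | hσ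
  · have h0 : ∀ᵐ ω ∂μ, ∀ t < T, η t ω = 0 := by
      rw [ae_all_iff]
      intro t
      by_cases ht : t < T
      · filter_upwards [(h.subgaussian t ht).ae_eq_zero (hle t ht)] with ω hω _ using hω
      · exact Filter.Eventually.of_forall fun ω h' => absurd h' ht
    refine le_of_eq_of_le ?_ zero_le
    rw [measure_eq_zero_iff_ae_notMem]
    filter_upwards [h0] with ω hω
    rintro ⟨t, ht, hlt⟩
    have : noiseSum (fun i => x i ω) (fun i => a i ω) (fun i => η i ω) t b = 0 :=
      Finset.sum_eq_zero fun i hi => by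
        simp only [hω i ((Finset.mem_range.1 hi).trans ht), zero_smul]
    simp [this] at hlt
  · have hx : ∀ t, ∀ i ≤ t, Measurable[history x a r t] (x i) := fun t i hi =>
      Measurable.of_comap_le (le_sup_of_le_left (le_sup_of_le_left
        (le_iSup₂_of_le i hi le_rfl)))
    have ha : ∀ t, ∀ i ≤ t, Measurable[history x a r t] (a i) := fun t i hi =>
      Measurable.of_comap_le (le_sup_of_le_left (le_sup_of_le_right
        (le_iSup₂_of_le i hi le_rfl)))
    have hr : ∀ t, ∀ i < t, Measurable[history x a r t] (r i) := fun t i hi =>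
      Measurable.of_comap_le (le_sup_of_le_right (le_iSup₂_of_le i hi le_rfl))
    have hreward := h.reward_eq
    -- The history contains rewards, not noise; the noise is recovered as reward minus mean.
    have hη : ∀ i < T, ∀ m : MeasurableSpace Ω, Measurable[m] (x i) → Measurable[m] (a i) →
        Measurable[m] (r i) → Measurable[m] (η i) := by
      intro i hi m hx ha hr
      have e : η i = fun ω => r i ω - inner ℝ (x i ω) (θs (a i ω)) := by
        funext ω
        rw [hreward i hi ω]
        ring
      rw [e]
      exact measurable_sub_inner θs hx ha hr
    have key := measure_exists_potential_gt_le (T := T) (ℱ := history x a r)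
      (ξ := fun i ω => η i ω / σ) hlam b hle (fun t _ => hx t) (fun t _ => ha t)
      (fun t ht i hi => (hη i (by omega) _ (hx t i hi.le) (ha t i hi.le) (hr t i hi)).div_const σ)
      (fun t ht => (hη t ht m0 (h.measurable_context t ht) (h.measurable_action t ht)
        (h.measurable_reward t ht)).div_const σ)
      (fun t ht => (h.subgaussian t ht).div_const hσ.ne') hp
    refine le_trans (measure_mono ?_) key
    rintro ω ⟨t, ht, hlt⟩
    refine ⟨t, ht, ?_⟩
    rw [potential, noiseSum_div, Matrix.mulVec_smul, dotProduct_smul, smul_dotProduct,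
      ← Real.log_lt_iff_lt_exp (inv_pos.2 hp), smul_eq_mul, smul_eq_mul]
    have hσ2 : 0 < σ ^ 2 := by positivity
    rw [← lt_div_iff₀' hσ2] at hlt
    rw [← mul_assoc, ← mul_inv, ← sq, ← div_eq_inv_mul]
    linarith

end Confidence

/-! ### Deterministic part: confidence ellipsoids, elliptical potential, optimism. -/

section Regret

variable {d K T : ℕ} {σ lam Sx Sθ δ : ℝ}

lemma weightedNorm_inv_mulVec {V : Matrix (Fin d) (Fin d) ℝ} (hV : V.PosDef) (u : Fin d → ℝ) :
    weightedNorm V (WithLp.toLp 2 (V⁻¹ *ᵥ u)) = √(u ⬝ᵥ (V⁻¹ *ᵥ u)) := by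
  rw [weightedNorm, WithLp.ofLp_toLp, hV.mul_inv_mulVec, dotProduct_comm]

lemma ridgeEstimate_sub (hlam : 0 < lam) (θs : Fin K → Vec d) {x : ℕ → Vec d} {a : ℕ → Fin K}
    {η r : ℕ → ℝ} {t : ℕ} (hr : ∀ i < t, r i = inner ℝ (x i) (θs (a i)) + η i) (b : Fin K) :
    ridgeEstimate lam x a r t b - θs b =
      WithLp.toLp 2 ((designMatrix lam x a t b)⁻¹ *ᵥ noiseSum x a η t b) -
      lam • WithLp.toLp 2 ((designMatrix lam x a t b)⁻¹ *ᵥ (θs b).ofLp) := by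
  have hV := designMatrix_posDef hlam x a t b
  -- Inserting the reward model turns the regression target into S + (V - λI)θ*.
  have key : ∑ i ∈ (Finset.range t).filter (fun i => a i = b), r i • (x i).ofLp =
      noiseSum x a η t b + (designMatrix lam x a t b *ᵥ (θs b).ofLp - lam • (θs b).ofLp) := by
    rw [designMatrix_eq, Matrix.add_mulVec, Matrix.smul_mulVec, Matrix.one_mulVec,
      add_sub_cancel_left, Matrix.sum_mulVec, noiseSum, ← Finset.sum_add_distrib,
      Finset.sum_filter]
    refine Finset.sum_congr rfl fun i hi => ?_
    rw [armContext]
    split_ifs with h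
    · rw [hr i (Finset.mem_range.1 hi), h, Matrix.vecMulVec_mulVec, op_smul_eq_smul, ← add_smul,
        add_comm (η i)]
      simp [EuclideanSpace.inner_eq_star_dotProduct, dotProduct_comm]
    · simp
  ext j
  rw [ridgeEstimate, key, Matrix.mulVec_add, Matrix.mulVec_sub, hV.inv_mul_mulVec,
    Matrix.mulVec_smul]
  simp
  ring

lemma sum_norm_sq_le {x : ℕ → Vec d} {t : ℕ} (hx : ∀ i < t, ‖x i‖ ≤ Sx) :
    ∑ i ∈ Finset.range t, ‖x i‖ ^ 2 ≤ t * Sx ^ 2 := by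
  have := Finset.sum_le_card_nsmul (Finset.range t) (fun i => ‖x i‖ ^ 2) (Sx ^ 2) fun i hi =>
    pow_le_pow_left₀ (norm_nonneg _) (hx i (Finset.mem_range.1 hi)) 2
  simpa using this

lemma logDetRatio_le_of_norm_le (hlam : 0 < lam) {x : ℕ → Vec d} {a : ℕ → Fin K} {t : ℕ}
    (hx : ∀ i < t, ‖x i‖ ≤ Sx) (b : Fin K) :
    logDetRatio lam x a t b ≤ d * Real.log (1 + t * Sx ^ 2 / lam) := by
  refine (logDetRatio_le hlam x a t b).trans ?_
  rcases Nat.eq_zero_or_pos d with rfl | hd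
  · simp
  have hd1 : (1 : ℝ) ≤ d := by exact_mod_cast hd
  have hs0 : 0 ≤ ∑ i ∈ Finset.range t, if a i = b then ‖x i‖ ^ 2 else 0 :=
    Finset.sum_nonneg fun i _ => by split_ifs <;> positivity
  have hs : ∑ i ∈ Finset.range t, (if a i = b then ‖x i‖ ^ 2 else 0) ≤ t * Sx ^ 2 := by
    refine le_trans (Finset.sum_le_sum fun i _ => ?_) (sum_norm_sq_le hx)
    split_ifs
    · exact le_rfl
    · positivity
  gcongr
  exact le_mul_of_one_le_right hlam.le hd1

lemma one_le_div_of_fin (b : Fin K) (hδ : 0 < δ) (hδ1 : δ < 1) : 1 ≤ K / δ := by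
  have : (1 : ℝ) ≤ K := by exact_mod_cast Fin.pos b
  rw [le_div_iff₀ hδ]
  linarith

lemma mem_confidenceSet (hσ : 0 ≤ σ) (hlam : 0 < lam) (hδ : 0 < δ) (hδ1 : δ < 1)
    {θs : Fin K → Vec d} (hθ : ∀ b, ‖θs b‖ ≤ Sθ) {x : ℕ → Vec d} {a : ℕ → Fin K}
    {η r : ℕ → ℝ} {t : ℕ} (hr : ∀ i < t, r i = inner ℝ (x i) (θs (a i)) + η i)
    (hx : ∀ i < t, ‖x i‖ ≤ Sx) (b : Fin K)
    (hS : noiseSum x a η t b ⬝ᵥ ((designMatrix lam x a t b)⁻¹ *ᵥ noiseSum x a η t b) ≤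
      σ ^ 2 * (2 * Real.log (δ / K)⁻¹ + logDetRatio lam x a t b)) :
    θs b ∈ confidenceSet σ lam Sx Sθ δ x a r t b := by
  have hV := designMatrix_posDef hlam x a t b
  have hKδ := one_le_div_of_fin b hδ hδ1
  have hu : (1 : ℝ) ≤ 1 + t * Sx ^ 2 / lam := by
    have : 0 ≤ t * Sx ^ 2 / lam := by positivity
    linarith
  have hlogK := Real.log_nonneg hKδ
  have hlogu := Real.log_nonneg hu
  have hlog : Real.log (K * (1 + t * Sx ^ 2 / lam) / δ) =
      Real.log (K / δ) + Real.log (1 + t * Sx ^ 2 / lam) := by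
    rw [mul_div_right_comm, Real.log_mul (by positivity) (by positivity)]
  -- The factor max d 2 dominates both the 2 before log (K / δ) and the d of the log-determinant
  -- bound.
  have hd : (d : ℝ) ≤ (max d 2 : ℕ) := by exact_mod_cast le_max_left d 2
  have h2 : (2 : ℝ) ≤ (max d 2 : ℕ) := by exact_mod_cast le_max_right d 2
  rw [confidenceSet, Set.mem_ofPred_eq, ridgeEstimate_sub hlam θs hr]
  refine (weightedNorm_sub_le hV.posSemidef _ _).trans (add_le_add ?_ ?_)
  · rw [weightedNorm_inv_mulVec hV, ← Real.sqrt_sq hσ, ← Real.sqrt_mul (sq_nonneg σ)]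
    refine Real.sqrt_le_sqrt (hS.trans ?_)
    rw [inv_div, hlog, mul_add ((max d 2 : ℕ) : ℝ)]
    have := logDetRatio_le_of_norm_le (a := a) hlam hx b
    gcongr
    exact this.trans (by gcongr)
  · rw [← WithLp.toLp_smul, ← Matrix.mulVec_smul, weightedNorm_inv_mulVec hV]
    have hSθ : 0 ≤ Sθ := (norm_nonneg _).trans (hθ b)
    rw [← Real.sqrt_sq hSθ, ← Real.sqrt_mul hlam.le]
    refine Real.sqrt_le_sqrt ?_
    refine (quadForm_designMatrix_inv_le hlam x a t b _).trans ?_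
    rw [div_le_iff₀ hlam, smul_dotProduct, dotProduct_smul, dotProduct_self_ofLp, smul_eq_mul,
      smul_eq_mul]
    have := pow_le_pow_left₀ (norm_nonneg _) (hθ b) 2
    have hl2 : 0 ≤ lam * lam := by positivity
    nlinarith

lemma radius_mono (b : Fin K) (hσ : 0 ≤ σ) (hlam : 0 < lam) (hδ : 0 < δ) {s t : ℕ}
    (h : s ≤ t) : radius d K σ lam Sx Sθ δ s ≤ radius d K σ lam Sx Sθ δ t := by
  have hK : (0 : ℝ) < K := by exact_mod_cast Fin.pos b
  have : (s : ℝ) ≤ t := by exact_mod_cast h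
  unfold radius
  gcongr

/-- Round t changes only the determinant of the action played, so the increments of all actions
telescope together. -/
lemma sum_log_one_add_eq (hlam : 0 < lam) (x : ℕ → Vec d) (a : ℕ → Fin K) (T : ℕ) :
    ∑ t ∈ Finset.range T, Real.log
        (1 + (x t).ofLp ⬝ᵥ ((designMatrix lam x a t (a t))⁻¹ *ᵥ (x t).ofLp)) =
      ∑ b, logDetRatio lam x a T b := by
  induction T with
  | zero => simp [logDetRatio_zero hlam]
  | succ T ih =>
    simp_rw [Finset.sum_range_succ, logDetRatio_succ hlam, Finset.sum_add_distrib, ih]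
    congr 1
    rw [Finset.sum_eq_single (a T)]
    · simp [armContext]
    · intro b _ hb
      simp [armContext, hb.symm]
    · simp

lemma sum_logDetRatio_le (b₀ : Fin K) (hlam : 0 < lam) {x : ℕ → Vec d} {a : ℕ → Fin K}
    (hx : ∀ t < T, ‖x t‖ ≤ Sx) :
    ∑ b, logDetRatio lam x a T b ≤
      K * (d * Real.log (1 + T * Sx ^ 2 / (lam * d * K))) := by
  have hK : (0 : ℝ) < K := by exact_mod_cast Fin.pos b₀
  refine (Finset.sum_le_sum fun b _ => logDetRatio_le hlam x a T b).trans ?_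
  rw [← Finset.mul_sum, mul_left_comm]
  refine mul_le_mul_of_nonneg_left ?_ (Nat.cast_nonneg d)
  set s : Fin K → ℝ := fun b => ∑ i ∈ Finset.range T, if a i = b then ‖x i‖ ^ 2 else 0
  have hs0 : ∀ b, 0 ≤ s b := fun b => Finset.sum_nonneg fun i _ => by split_ifs <;> positivity
  have hsum : ∑ b, s b ≤ T * Sx ^ 2 := by
    refine le_trans (le_of_eq ?_) (sum_norm_sq_le hx)
    rw [Finset.sum_comm]
    exact Finset.sum_congr rfl fun i _ => by simp
  have hpos : ∀ b, 0 < 1 + s b / (lam * d) := fun b => by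
    have := hs0 b
    positivity
  -- Jensen across actions: the worst case spreads the total squared context norm, at most T Sx²,
  -- evenly.
  have h := strictConcaveOn_log_Ioi.concaveOn.le_map_sum (t := Finset.univ)
    (w := fun _ : Fin K => (K : ℝ)⁻¹) (p := fun b => 1 + s b / (lam * d))
    (fun _ _ => by positivity) (by simp [hK.ne']) (fun b _ => hpos b)
  simp only [smul_eq_mul, ← Finset.mul_sum] at h
  rw [inv_mul_le_iff₀ hK] at h
  refine h.trans (mul_le_mul_of_nonneg_left (Real.log_le_log ?_ ?_) hK.le)
  · exact mul_pos (inv_pos.2 hK) (Finset.sum_pos (fun b _ => hpos b) ⟨b₀, Finset.mem_univ _⟩)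
  · rw [Finset.sum_add_distrib, ← Finset.sum_div]
    simp only [Finset.sum_const, Finset.card_univ, Fintype.card_fin, nsmul_eq_mul, mul_one]
    rw [mul_add, inv_mul_cancel₀ hK.ne', ← div_eq_inv_mul, div_div]
    gcongr

lemma le_mul_log_one_add {w L : ℝ} (hw : 0 ≤ w) (hL : w ≤ L) :
    w ≤ 2 * max 1 L * Real.log (1 + w) := by
  have h1 : 0 < 1 + w := by positivity
  have h2 := Real.one_sub_inv_le_log_of_pos h1
  have h3 : w ≤ (1 + w) * Real.log (1 + w) := by
    have := mul_le_mul_of_nonneg_left h2 h1.le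
    rw [mul_sub, mul_inv_cancel₀ h1.ne'] at this
    linarith
  refine h3.trans (mul_le_mul_of_nonneg_right ?_ (Real.log_nonneg (by linarith)))
  linarith [le_max_left 1 L, le_max_right 1 L]

/-- The elliptical potential bound, summed over all actions. -/
lemma sum_weightedNorm_le (b₀ : Fin K) (hlam : 0 < lam) {x : ℕ → Vec d} {a : ℕ → Fin K}
    (hx : ∀ t < T, ‖x t‖ ≤ Sx) :
    ∑ t ∈ Finset.range T, weightedNorm (designMatrix lam x a t (a t))⁻¹ (x t) ≤
      2 * max 1 (Sx / √lam) * √(d * Real.log (1 + T * Sx ^ 2 / (lam * d * K))) *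
        √(K * T) := by
  rcases Nat.eq_zero_or_pos T with rfl | hT
  · simp
  have hSx : 0 ≤ Sx := (norm_nonneg _).trans (hx 0 hT)
  set w : ℕ → ℝ := fun t =>
    (x t).ofLp ⬝ᵥ ((designMatrix lam x a t (a t))⁻¹ *ᵥ (x t).ofLp)
  have hw0 : ∀ t, 0 ≤ w t := fun t =>
    (designMatrix_posDef hlam x a t (a t)).posSemidef.inv.quadForm_nonneg _
  have hwL : ∀ t < T, w t ≤ Sx ^ 2 / lam := fun t ht => by
    refine (quadForm_designMatrix_inv_le hlam x a t (a t) _).trans ?_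
    rw [dotProduct_self_ofLp]
    have := hx t ht
    gcongr
  have hsum : ∑ t ∈ Finset.range T, w t ≤ 2 * max 1 (Sx ^ 2 / lam) *
      (K * (d * Real.log (1 + T * Sx ^ 2 / (lam * d * K)))) := by
    refine (Finset.sum_le_sum fun t ht =>
      le_mul_log_one_add (hw0 t) (hwL t (Finset.mem_range.1 ht))).trans ?_
    rw [← Finset.mul_sum, sum_log_one_add_eq hlam]
    exact mul_le_mul_of_nonneg_left (sum_logDetRatio_le b₀ hlam hx) (by positivity)
  have hmax : max 1 (Sx ^ 2 / lam) ≤ max 1 (Sx / √lam) ^ 2 := by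
    refine max_le (one_le_pow₀ (le_max_left _ _)) ?_
    rw [show Sx ^ 2 / lam = (Sx / √lam) ^ 2 by rw [div_pow, Real.sq_sqrt hlam.le]]
    exact pow_le_pow_left₀ (by positivity) (le_max_right _ _) 2
  have hlog : 0 ≤ d * Real.log (1 + T * Sx ^ 2 / (lam * d * K)) := by
    refine mul_nonneg (Nat.cast_nonneg d) (Real.log_nonneg ?_)
    have : 0 ≤ T * Sx ^ 2 / (lam * d * K) := by positivity
    linarith
  set A := d * Real.log (1 + T * Sx ^ 2 / (lam * d * K))
  set m := max 1 (Sx / √lam)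
  have hm : 0 ≤ m := zero_le_one.trans (le_max_left _ _)
  have hcs := sq_sum_le_card_mul_sum_sq (s := Finset.range T) (f := fun t => √(w t))
  simp only [Real.sq_sqrt (hw0 _), Finset.card_range] at hcs
  refine le_trans (Real.le_sqrt_of_sq_le hcs) ?_
  rw [Real.sqrt_le_left (by positivity)]
  rw [mul_pow, mul_pow, mul_pow, Real.sq_sqrt hlog, Real.sq_sqrt (by positivity)]
  calc (T : ℝ) * ∑ t ∈ Finset.range T, w t ≤ T * (2 * m ^ 2 * (K * A)) := by
        refine mul_le_mul_of_nonneg_left (hsum.trans ?_) (Nat.cast_nonneg T)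
        gcongr
    -- The constant √2 is rounded up to 2.
    _ ≤ 2 ^ 2 * m ^ 2 * A * (K * T) := by
        have : 0 ≤ T * (m ^ 2 * (K * A)) := by positivity
        linarith

/-- The regret bound on the event that the confidence ellipsoids hold the true parameters. -/
theorem regret_le (hσ : 0 ≤ σ) (hlam : 0 < lam) (hδ : 0 < δ)
    {θs : Fin K → Vec d} {x : ℕ → Vec d} {a : ℕ → Fin K} {r : ℕ → ℝ} (pol : Vec d → Fin K)
    (hx : ∀ t < T, ‖x t‖ ≤ Sx) (hrun : IsRun σ lam Sx Sθ δ T x a r)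
    (hmem : ∀ t < T, ∀ b, θs b ∈ confidenceSet σ lam Sx Sθ δ x a r t b) :
    regret θs pol x a T ≤ 4 * max 1 (Sx / √lam) * radius d K σ lam Sx Sθ δ T *
      √(d * Real.log (1 + T * Sx ^ 2 / (lam * d * K))) * √(K * T) := by
  rcases Nat.eq_zero_or_pos T with rfl | hT
  · simp [regret]
  have hstep : ∀ t < T, inner ℝ (x t) (θs (pol (x t))) - inner ℝ (x t) (θs (a t)) ≤
      2 * radius d K σ lam Sx Sθ δ T *
        weightedNorm (designMatrix lam x a t (a t))⁻¹ (x t) := by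
    intro t ht
    obtain ⟨θt, hθt, hopt⟩ := hrun t ht
    have hV := designMatrix_posDef hlam x a t (a t)
    -- Optimism: the comparator's true parameter is a feasible choice, so its value is at most that
    -- of θt.
    have h1 := hopt (pol (x t)) _ (hmem t ht _)
    have h2 := inner_le_weightedNorm hV (x t) (θt - θs (a t))
    have h3 : weightedNorm (designMatrix lam x a t (a t)) (θt - θs (a t)) ≤
        2 * radius d K σ lam Sx Sθ δ T := by
      -- Both parameters lie in the same ellipsoid, hence two radii.
      have e : θt - θs (a t) = (ridgeEstimate lam x a r t (a t) - θs (a t)) -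
          (ridgeEstimate lam x a r t (a t) - θt) := by abel
      rw [e]
      refine (weightedNorm_sub_le hV.posSemidef _ _).trans ?_
      have h4 : weightedNorm _ _ ≤ _ := hmem t ht (a t)
      have h5 : weightedNorm _ _ ≤ _ := hθt
      linarith [radius_mono (d := d) (Sx := Sx) (Sθ := Sθ) (a t) hσ hlam hδ ht.le]
    rw [inner_sub_right] at h2
    have h5 : 0 ≤ weightedNorm (designMatrix lam x a t (a t))⁻¹ (x t) := Real.sqrt_nonneg _
    have h6 := mul_le_mul_of_nonneg_left h3 h5
    linarith
  -- Nonnegativity follows because the ellipsoid of round 0 is nonempty.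
  have hrad : 0 ≤ radius d K σ lam Sx Sθ δ T :=
    (Real.sqrt_nonneg _).trans ((hmem 0 hT (a 0)).trans
      (radius_mono (a 0) hσ hlam hδ (Nat.zero_le T)))
  refine (Finset.sum_le_sum fun t ht => hstep t (Finset.mem_range.1 ht)).trans ?_
  rw [← Finset.mul_sum]
  refine (mul_le_mul_of_nonneg_left (sum_weightedNorm_le (a 0) hlam hx)
    (by positivity)).trans (le_of_eq ?_)
  ring

end Regret

/-! ### Union bound over actions. -/

section HighProbability

variable {Ω : Type*} [MeasurableSpace Ω] {μ : Measure Ω} [IsProbabilityMeasure μ]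
  {d K T : ℕ} {σ lam Sx Sθ δ : ℝ} {θs : Fin K → Vec d}
  {x : ℕ → Ω → Vec d} {a : ℕ → Ω → Fin K} {η r : ℕ → Ω → ℝ}

theorem DisjointLinearModel.le_measure_regret_le (h : DisjointLinearModel μ T σ θs x a η r)
    (b₀ : Fin K) (hσ : 0 ≤ σ) (hlam : 0 < lam) (hδ : 0 < δ) (hδ1 : δ < 1)
    (pol : Vec d → Fin K) (hθ : ∀ b, ‖θs b‖ ≤ Sθ) (hx : ∀ t < T, ∀ᵐ ω ∂μ, ‖x t ω‖ ≤ Sx)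
    (hrun : ∀ᵐ ω ∂μ, IsRun σ lam Sx Sθ δ T
      (fun t => x t ω) (fun t => a t ω) (fun t => r t ω)) :
    ENNReal.ofReal (1 - δ) ≤
      μ {ω | regret θs pol (fun t => x t ω) (fun t => a t ω) T ≤
        4 * max 1 (Sx / √lam) * radius d K σ lam Sx Sθ δ T *
          √(d * Real.log (1 + T * Sx ^ 2 / (lam * d * K))) * √(K * T)} := by
  have hK : (0 : ℝ) < K := by exact_mod_cast Fin.pos b₀
  have hp : 0 < δ / K := by positivity
  have hunion := measure_iUnion_fintype_le μ (fun b : Fin K =>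
    {ω | ∃ t < T, σ ^ 2 * (2 * Real.log (δ / K)⁻¹ +
        logDetRatio lam (fun i => x i ω) (fun i => a i ω) t b) <
      noiseSum (fun i => x i ω) (fun i => a i ω) (fun i => η i ω) t b ⬝ᵥ
        ((designMatrix lam (fun i => x i ω) (fun i => a i ω) t b)⁻¹ *ᵥ
          noiseSum (fun i => x i ω) (fun i => a i ω) (fun i => η i ω) t b)})
  set bad : Fin K → Set Ω := fun b => _
  have hbad : μ (⋃ b, bad b) ≤ ENNReal.ofReal δ := by
    refine hunion.trans ((Finset.sum_le_sum fun b _ =>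
      h.measure_exists_noiseSum_gt_le hσ hlam b hp).trans (le_of_eq ?_))
    rw [Finset.sum_const, Finset.card_univ, Fintype.card_fin, nsmul_eq_mul,
      ← ENNReal.ofReal_natCast, ← ENNReal.ofReal_mul hK.le, mul_div_cancel₀ _ hK.ne']
  have hxall : ∀ᵐ ω ∂μ, ∀ t < T, ‖x t ω‖ ≤ Sx := by
    rw [ae_all_iff]
    intro t
    by_cases ht : t < T
    · filter_upwards [hx t ht] with ω hω _ using hω
    · exact Filter.Eventually.of_forall fun ω h' => absurd h' ht
  have hgood : μ (⋃ b, bad b)ᶜ ≤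
      μ {ω | regret θs pol (fun t => x t ω) (fun t => a t ω) T ≤
        4 * max 1 (Sx / √lam) * radius d K σ lam Sx Sθ δ T *
          √(d * Real.log (1 + T * Sx ^ 2 / (lam * d * K))) * √(K * T)} := by
    refine measure_mono_ae ?_
    filter_upwards [hxall, hrun] with ω hω hrunω hmem
    refine regret_le hσ hlam hδ pol hω hrunω fun t ht b => ?_
    refine mem_confidenceSet hσ hlam hδ hδ1 hθ (η := fun i => η i ω)
      (fun i hi => h.reward_eq i (hi.trans ht) ω) (fun i hi => hω i (hi.trans ht)) b ?_
    by_contra hcon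
    exact hmem (Set.mem_iUnion.2 ⟨b, t, ht, not_le.1 hcon⟩)
  refine le_trans ?_ hgood
  -- Subadditivity suffices here, so no measurability of the bad events is needed.
  have huniv : (1 : ENNReal) ≤ μ (⋃ b, bad b) + μ (⋃ b, bad b)ᶜ := by
    rw [← measure_univ (μ := μ), ← Set.union_compl_self (⋃ b, bad b)]
    exact measure_union_le _ _
  rw [ENNReal.ofReal_sub _ hδ.le, ENNReal.ofReal_one]
  exact tsub_le_iff_left.2 (huniv.trans (by gcongr))

end HighProbability

end MOFUL

theorem theorem1 :
    ∃ C : ℝ, 0 < C ∧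
      ∀ (d K T : ℕ) (σ lam Sx Sθ δ : ℝ), 0 ≤ σ → 0 < lam → 0 < δ → δ < 1 →
      ∀ (Ω : Type*) [MeasurableSpace Ω] (μ : Measure Ω) [IsProbabilityMeasure μ]
        (θs : Fin K → MOFUL.Vec d)
        (x : ℕ → Ω → MOFUL.Vec d) (a : ℕ → Ω → Fin K) (η r : ℕ → Ω → ℝ)
        (pol : MOFUL.Vec d → Fin K),
        MOFUL.DisjointLinearModel μ T σ θs x a η r →
        (∀ b, ‖θs b‖ ≤ Sθ) →
        (∀ t < T, ∀ᵐ ω ∂μ, ‖x t ω‖ ≤ Sx) →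
        (∀ y b, inner ℝ y (θs b) ≤ inner ℝ y (θs (pol y))) →
        (∀ᵐ ω ∂μ, MOFUL.IsRun σ lam Sx Sθ δ T
          (fun t => x t ω) (fun t => a t ω) (fun t => r t ω)) →
        ENNReal.ofReal (1 - δ) ≤
          μ {ω | MOFUL.regret θs pol (fun t => x t ω) (fun t => a t ω) T ≤
            C * max 1 (Sx / √lam) * MOFUL.radius d K σ lam Sx Sθ δ T *
              √(d * Real.log (1 + T * Sx ^ 2 / (lam * d * K))) * √(K * T)} := by
  -- 4 = 2 · 2: two radii per round, and the factor 2 of the elliptical potential bound.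
  refine ⟨4, by norm_num, ?_⟩
  intro d K T σ lam Sx Sθ δ hσ hlam hδ hδ1 Ω _ μ _ θs x a η r pol h hθ hx _ hrun
  -- The value `pol 0` serves as a witness that there is at least one action.
  exact h.le_measure_regret_le (pol 0) hσ hlam hδ hδ1 pol hθ hx hrun
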